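/- A \emph{representation} of a set $X$ is a surjective partial map $\delta_X:\subseteq\mathbb{N}^{\mathbb{N}}\to X$; then $(X,\delta_X)$ is called a \emph{represented space}, and it carries the final topology $\mathcal{O}(X)=\{U\subseteq X:\delta_X^{-1}(U)\text{ is open in }\mathrm{dom}(\delta_X)\}$. A partial function $F:\subseteq\mathbb{N}^{\mathbb{N}}\to\mathbb{N}^{\mathbb{N}}$ \emph{realizes} a partial map $f:\subseteq X\to Y$ between represented spaces if $\delta_Y(F(p))=f(\delta_X(p))$ for all $p\in\mathrm{dom}(f\circ\delta_X)$, and $f$ is \emph{continuous with respect to the representations} if it has a realizer that is continuous on its domain. A representation $\delta_X$ of $X$ is \emph{admissible} with respect to a topology $\tau$ on $X$ if (1) $\delta_X$ is continuous with respect to $\tau$ on its domain, and (2) every representation $\delta:\subseteq\mathbb{N}^{\mathbb{N}}\to X$ that is continuous with respect to $\tau$ on its domain is also continuous with respect to the representation $\delta_X$, i.e., there is a partial function $F:\subseteq\mathbb{N}^{\mathbb{N}}\to\mathbb{N}^{\mathbb{N}}$, continuous on its domain, with $\delta_X(F(p))=\delta(p)$ for all $p\in\mathrm{dom}(\delta)$.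 For a represented space $Y$, let $\delta_{\mathcal{O}(Y)}$ be the standard representation of $\mathcal{O}(Y)$: $\delta_{\mathcal{O}(Y)}(p)=U$ if and only if the partial continuous function $\eta_p:\subseteq\mathbb{N}^{\mathbb{N}}\to\mathbb{N}^{\mathbb{N}}$ with code (Kleene associate) $p$ realizes the characteristic function $\chi_U:Y\to\mathbb{S}$ into Sierpi\'nski space $\mathbb{S}=\{0,1\}$, where the constant zero sequence is the only name of $0\in\mathbb{S}$ and all other sequences are names of $1$. Here $\eta_p(q)(n)=p\langle n,q|_k\rangle-1$ for the least $k$ with $p\langle n,q|_k\rangle\neq0$, where $q|_k$ is the prefix of $q$ of length $k$ and $\langle\cdot\rangle$ is a standard coding of pairs of a number and a finite word by numbers; $\eta_p(q)$ is defined if and only if such a $k$ exists for every $n$. A family $(B_y)_{y\in Y}$ of subsets of a set $X$, indexed by a represented space $Y$, is a \emph{presubbase} of $X$ if $\{y\in Y:x\in B_y\}\in\mathcal{O}(Y)$ for every $x\in X$ and the map $X\to\mathcal{O}(Y)$, $x\mapsto\{y\in Y:x\in B_y\}$ is injective. Its \emph{presubbase representation} $\delta^B:\subseteq\mathbb{N}^{\mathbb{N}}\to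 X$ is defined by \[\delta^B(p)=x:\iff\delta_{\mathcal{O}(Y)}(p)=\{y\in Y:x\in B_y\}.\] The presubbase has the \emph{convergent intersection property} if for every sequence $(y_n)_{n\in\mathbb{N}}$ in $Y$ and every $y_\infty\in Y$ such that $y_n\to y_\infty$ with respect to $\mathcal{O}(Y)$, there is a finite set $F\subseteq Y$ with \[B_{y_\infty}\cap\bigcap_{n\in\mathbb{N}}B_{y_n}=\bigcap_{y\in F}B_y,\] where the empty intersection is $X$. \textbf{Corollary 12 (Convergent intersection property).} Let $(B_y)_{y\in Y}$ be a presubbase of a set $X$ that satisfies the convergent intersection property. Then $\delta^B$ is admissible with respect to the topology $\tau$ on $X$ that is generated by $\{B_y:y\in Y\}$ as a subbase. -/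

import Mathlib

open Filter Topology

/-- Baire space, with the product of the discrete topologies. -/
abbrev Baire : Type := ℕ → ℕ

/-- A partial map out of a topological space is continuous with respect to a topology `τ` on its
codomain if its restriction to its domain (with the subspace topology) is continuous. -/
def PartialContinuous {A X : Type*} [TopologicalSpace A] (τ : TopologicalSpace X)
    (f : A →. X) : Prop :=
  @Continuous f.Dom X inferInstance τ f.asSubtype

/-- A representation of `X`: a surjective partial map from Baire space to `X`. -/
structure BaireRep (X : Type*) where
  /-- The underlying partial map; `x ∈ toPFun p` says that `p` is a name of `x`. -/
  toPFun : Baire →. X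
  surj : ∀ x, ∃ p, x ∈ toPFun p

namespace BaireRep

/-- The identity representation of Baire space. -/
def baire : BaireRep Baire where
  toPFun := PFun.id Baire
  surj := fun x => ⟨x, Part.mem_some x⟩

/-- The standard representation of Sierpiński space (in Mathlib: `Prop`): `0^ω` is the only name
of the bottom element and every other sequence is a name of the top element. -/
def sierpinski : BaireRep Prop where
  toPFun := fun p => Part.some (∃ n, p n ≠ 0)
  surj := by
    intro P
    by_cases hP : P
    · exact ⟨fun _ => 1, by simp [hP]⟩
    · exact ⟨fun _ => 0, by simp [hP]⟩

/-- The final topology of a represented space. -/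
@[reducible]
def finalTopology {X : Type*} (δ : BaireRep X) : TopologicalSpace X :=
  TopologicalSpace.coinduced δ.toPFun.asSubtype inferInstance

/-- `F` realizes the partial single-valued map `f`: whenever `p` is a name of a point `x` in the
domain of `f`, then `F p` is defined and is a name of `f x`. -/
def Realizes {X Y : Type*} (δX : BaireRep X) (δY : BaireRep Y) (F : Baire →. Baire)
    (f : X →. Y) : Prop :=
  ∀ p, ∀ x ∈ δX.toPFun p, ∀ y ∈ f x, ∃ q ∈ F p, y ∈ δY.toPFun q

/-- `f` is continuous with respect to the representations: it has a continuous realizer. -/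
def RepContinuous {X Y : Type*} (δX : BaireRep X) (δY : BaireRep Y) (f : X →. Y) : Prop :=
  ∃ F : Baire →. Baire, PartialContinuous inferInstance F ∧ Realizes δX δY F f

/-- `δ` is admissible with respect to the topology `τ`: it is continuous with respect to `τ`, and
every representation that is continuous with respect to `τ` is, as a partial map from Baire space,
continuous with respect to the representation `δ`. -/
def Admissible {X : Type*} (δ : BaireRep X) (τ : TopologicalSpace X) : Prop :=
  PartialContinuous τ δ.toPFun ∧
    ∀ δ' : BaireRep X, PartialContinuous τ δ'.toPFun → RepContinuous baire δ δ'.toPFun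

end BaireRep

/-- The code of a number `n` together with the prefix of `q` of length `k`. -/
def prefixCode (n : ℕ) (q : Baire) (k : ℕ) : ℕ :=
  Encodable.encode (n, (List.range k).map q)

/-- The partial continuous function with associate `p` (in Kleene's sense): the value of
`kleene p q` at `n` is `m` if `p` takes the value `m + 1` on the code of `n` and the shortest
prefix of `q` for which `p` does not answer `0`. -/
def kleene (p : Baire) : Baire →. Baire := fun q =>
  { Dom := ∀ n, ∃ k, p (prefixCode n q k) ≠ 0
    get := fun h n => p (prefixCode n q (Nat.find (h n))) - 1 }

namespace BaireRep

/-- The function space representation: `p` is a name of the total function `f` if the partial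
continuous function with associate `p` realizes `f`. -/
def NamesFunction {X Y : Type*} (δX : BaireRep X) (δY : BaireRep Y) (p : Baire) (f : X → Y) :
    Prop :=
  Realizes δX δY (kleene p) (f : X →. Y)

/-- The open sets of a represented space, with respect to its final topology. -/
abbrev OpenSets {Y : Type*} (δ : BaireRep Y) : Type _ :=
  {U : Set Y // IsOpen[δ.finalTopology] U}

/-- `p` is a name of the open set `U` if it is a name of the characteristic function of `U` as a
function into Sierpiński space. -/
def NamesOpen {Y : Type*} (δ : BaireRep Y) (p : Baire) (U : δ.OpenSets) : Prop :=
  NamesFunction δ sierpinski p (fun y => y ∈ U.1)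

theorem NamesOpen.unique {Y : Type*} {δ : BaireRep Y} {p : Baire} {U V : δ.OpenSets}
    (hU : δ.NamesOpen p U) (hV : δ.NamesOpen p V) : U = V := by
  have key : U.1 = V.1 := by
    ext y
    obtain ⟨q, hq⟩ := δ.surj y
    obtain ⟨r, hr, h1⟩ := hU q y hq _ (Part.mem_some _)
    obtain ⟨s, hs, h2⟩ := hV q y hq _ (Part.mem_some _)
    obtain rfl := Part.mem_unique hr hs
    exact iff_of_eq (Part.mem_unique h1 h2)
  exact Subtype.ext key

theorem exists_namesOpen {Y : Type*} (δ : BaireRep Y) (U : δ.OpenSets) :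
    ∃ p, δ.NamesOpen p U := by
  classical
  have hU : IsOpen (δ.toPFun.asSubtype ⁻¹' U.1) := U.2
  obtain ⟨V, hV, hVU⟩ := isOpen_induced_iff.1 hU
  let p : Baire := fun c =>
    match (Encodable.decode c : Option (ℕ × List ℕ)) with
    | none => 0
    | some (n, w) =>
      if w.length < n then 0
      else if ∀ q : Baire, (List.range w.length).map q = w → q ∈ V then 2 else 1
  have hp : ∀ n q k, p (prefixCode n q k) =
      if k < n then 0
      else if ∀ q' : Baire, (List.range k).map q' = (List.range k).map q → q' ∈ V
        then 2 else 1 := by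
    intro n q k
    simp [p, prefixCode]
  have hdom : ∀ q n, ∃ k, p (prefixCode n q k) ≠ 0 := by
    intro q n
    refine ⟨n, ?_⟩
    rw [hp]
    simp only [lt_irrefl, if_false]
    split_ifs <;> simp
  refine ⟨p, ?_⟩
  intro q y hy b hb
  obtain rfl := Part.mem_some_iff.1 hb
  refine ⟨(kleene p q).get (hdom q), Part.get_mem _, ?_⟩
  refine Part.mem_some_iff.2 (propext ?_)
  have hyV : y ∈ U.1 ↔ q ∈ V := by
    have hq : q ∈ δ.toPFun.Dom := Part.dom_iff_mem.2 ⟨y, hy⟩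
    have h := Set.ext_iff.1 hVU ⟨q, hq⟩
    have hval : δ.toPFun.asSubtype ⟨q, hq⟩ = y := Part.get_eq_of_mem hy hq
    simp only [Set.mem_preimage, hval] at h
    exact h.symm
  refine hyV.trans ?_
  constructor
  · intro hqV
    obtain ⟨_, ⟨x, m, rfl⟩, hqc, hsub⟩ :=
      (PiNat.isTopologicalBasis_cylinders (fun _ : ℕ => ℕ)).exists_subset_of_mem_open hqV hV
    refine ⟨m, ?_⟩
    change p (prefixCode m q (Nat.find (hdom q m))) - 1 ≠ 0
    have hk := Nat.find_spec (hdom q m)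
    generalize Nat.find (hdom q m) = k at hk
    rw [hp] at hk ⊢
    have hmk : ¬ k < m := fun h => hk (by simp [h])
    have hall : ∀ q' : Baire, (List.range k).map q' = (List.range k).map q → q' ∈ V := by
      intro q' hq'
      apply hsub
      intro i hi
      have h2 : q' i = q i := List.map_inj_left.1 hq' i (List.mem_range.2 (by omega))
      rw [h2]
      exact hqc i hi
    rw [if_neg hmk, if_pos hall]
    simp
  · rintro ⟨n, hn⟩
    change p (prefixCode n q (Nat.find (hdom q n))) - 1 ≠ 0 at hn
    generalize Nat.find (hdom q n) = k at hn
    rw [hp] at hn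
    split_ifs at hn with h1 h2
    · simp at hn
    · exact h2 q rfl
    · simp at hn

/-- The standard representation of the open sets of a represented space. -/
noncomputable def openSets {Y : Type*} (δ : BaireRep Y) : BaireRep δ.OpenSets where
  toPFun := fun p => { Dom := ∃ U, δ.NamesOpen p U, get := fun h => h.choose }
  surj := fun U => by
    obtain ⟨p, hp⟩ := δ.exists_namesOpen U
    exact ⟨p, ⟨U, hp⟩, NamesOpen.unique (Exists.choose_spec (⟨U, hp⟩ : ∃ U, δ.NamesOpen p U)) hp⟩

theorem mem_openSets {Y : Type*} (δ : BaireRep Y) (p : Baire) (U : δ.OpenSets) :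
    U ∈ δ.openSets.toPFun p ↔ δ.NamesOpen p U := by
  constructor
  · rintro ⟨h, rfl⟩
    exact Exists.choose_spec h
  · intro hp
    exact ⟨⟨U, hp⟩, NamesOpen.unique (Exists.choose_spec (⟨U, hp⟩ : ∃ U, δ.NamesOpen p U)) hp⟩

end BaireRep

/-- A family `B` of subsets of `X`, indexed by a represented space, is a presubbase if its
transpose `x ↦ {y | x ∈ B y}` is well-defined as a map to the open sets, and injective. -/
structure IsPresubbase {X Y : Type*} (δY : BaireRep Y) (B : Y → Set X) : Prop where
  isOpen_transpose : ∀ x, IsOpen[δY.finalTopology] {y | x ∈ B y}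
  injective_transpose : Function.Injective fun x => {y | x ∈ B y}

namespace IsPresubbase

/-- The transpose of a presubbase. -/
def transpose {X Y : Type*} {δY : BaireRep Y} {B : Y → Set X} (hB : IsPresubbase δY B) (x : X) :
    δY.OpenSets :=
  ⟨{y | x ∈ B y}, hB.isOpen_transpose x⟩

theorem transpose_injective {X Y : Type*} {δY : BaireRep Y} {B : Y → Set X}
    (hB : IsPresubbase δY B) : Function.Injective hB.transpose := by
  intro x x' h
  exact hB.injective_transpose (congrArg Subtype.val h)

/-- The presubbase representation: `p` is a name of `x` if and only if `p` is a name of the open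
set `{y | x ∈ B y}` (see `mem_rep`). -/
noncomputable def rep {X Y : Type*} {δY : BaireRep Y} {B : Y → Set X} (hB : IsPresubbase δY B) :
    BaireRep X where
  toPFun := fun p =>
    { Dom := ∃ x, hB.transpose x ∈ δY.openSets.toPFun p
      get := fun h => h.choose }
  surj := fun x => by
    obtain ⟨p, hp⟩ := δY.openSets.surj (hB.transpose x)
    have h : ∃ x, hB.transpose x ∈ δY.openSets.toPFun p := ⟨x, hp⟩
    exact ⟨p, h, hB.transpose_injective (Part.mem_unique h.choose_spec hp)⟩

theorem mem_rep {X Y : Type*} {δY : BaireRep Y} {B : Y → Set X} (hB : IsPresubbase δY B)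
    (p : Baire) (x : X) :
    x ∈ hB.rep.toPFun p ↔ hB.transpose x ∈ δY.openSets.toPFun p := by
  constructor
  · rintro ⟨h, rfl⟩
    exact Exists.choose_spec h
  · intro hp
    have h : ∃ x, hB.transpose x ∈ δY.openSets.toPFun p := ⟨x, hp⟩
    exact ⟨h, hB.transpose_injective (Part.mem_unique h.choose_spec hp)⟩

end IsPresubbase

/-- The convergent intersection property. Convergence in `Y` is with respect to the final
topology. -/
def ConvergentIntersectionProperty {X Y : Type*} (δY : BaireRep Y) (B : Y → Set X) : Prop :=
  ∀ (y : ℕ → Y) (yInf : Y), Tendsto y atTop (@nhds Y δY.finalTopology yInf) →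
    ∃ F : Set Y, F.Finite ∧ (⋂ n, B (y n)) ∩ B yInf = ⋂ z ∈ F, B z

/-!
Evaluation of associates is continuous in the associate, so naming `{y | x ∈ B y}` makes every
condition `x ∈ B y` semidecidable from a name of `x`; this is continuity of the presubbase
representation. Conversely, suppose `x k → x∞` and `y k → y∞` with `x∞ ∈ B y∞`. Eventually
`x∞ ∈ B (y k)`, and the convergent intersection property turns the intersection of these sets into
a finite one, that is, into a neighbourhood of `x∞`; hence `x k ∈ B (y k)` eventually. So for
continuous `δ` the relation `δ p ∈ B (δY q)` is sequentially open, hence open in the first-countable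
space of pairs of names, and currying an open relation on Baire space yields a continuous realizer
into the representation of the open sets.
-/

theorem hasAntitoneBasis_nhds_cylinder {E : ℕ → Type*} [∀ n, TopologicalSpace (E n)]
    [∀ n, DiscreteTopology (E n)] (x : ∀ n, E n) :
    (𝓝 x).HasAntitoneBasis (PiNat.cylinder x) := by
  refine ⟨⟨fun s => ⟨fun hs => ?_, fun ⟨n, _, hn⟩ => ?_⟩⟩, fun _ _ => PiNat.cylinder_anti x⟩
  · obtain ⟨_, ⟨z, n, rfl⟩, hxz, hsub⟩ := (PiNat.isTopologicalBasis_cylinders E).mem_nhds_iff.1 hs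
    exact ⟨n, trivial, PiNat.mem_cylinder_iff_eq.1 hxz ▸ hsub⟩
  · exact mem_of_superset ((PiNat.isOpen_cylinder E x n).mem_nhds (PiNat.self_mem_cylinder x n)) hn

theorem map_range_eq_map_range_iff {α : Type*} {p q : ℕ → α} {n : ℕ} :
    (List.range n).map p = (List.range n).map q ↔ p ∈ PiNat.cylinder q n := by
  simp only [List.map_inj_left, List.mem_range, PiNat.mem_cylinder_iff]

theorem partialContinuous_kleene_left (q : Baire) :
    PartialContinuous inferInstance fun p => kleene p q := by
  refine continuous_pi fun n => ((IsLocallyConstant.iff_eventually_eq _).2 fun p => ?_).continuous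
  have agree : ∀ᶠ p' in 𝓝 p, ∀ k ∈ Set.Iic (Nat.find (p.2 n)),
      p'.1 (prefixCode n q k) = p.1 (prefixCode n q k) :=
    (Set.finite_Iic _).eventually_all.2 fun k _ => ((IsLocallyConstant.iff_continuous _).2
      ((continuous_apply (prefixCode n q k)).comp continuous_subtype_val)).eventually_eq p
  filter_upwards [agree] with p' hp'
  have find_eq : Nat.find (p'.2 n) = Nat.find (p.2 n) := by
    refine (Nat.find_eq_iff _).2 ⟨?_, fun k hk => ?_⟩
    · exact hp' _ Set.self_mem_Iic ▸ Nat.find_spec (p.2 n)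
    · exact hp' k hk.le ▸ Nat.find_min (p.2 n) hk
  change p'.1 (prefixCode n q (Nat.find (p'.2 n))) - 1 = p.1 (prefixCode n q (Nat.find (p.2 n))) - 1
  rw [find_eq, hp' _ Set.self_mem_Iic]

/-- The associate of the function sending `q` to the sequence whose `n`-th entry is `g` of the
prefix of `q` of length `n`. It answers `0` on the code of `n` and `w` unless `w` has length `n`,
so that evaluation reads exactly the prefix of length `n`. -/
def prefixAssociate (g : List ℕ → ℕ) : Baire := fun c =>
  match (Encodable.decode c : Option (ℕ × List ℕ)) with
  | none => 0
  | some (n, w) => if w.length = n then g w + 1 else 0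

theorem prefixAssociate_prefixCode (g : List ℕ → ℕ) (n : ℕ) (q : Baire) (k : ℕ) :
    prefixAssociate g (prefixCode n q k) =
      if k = n then g ((List.range k).map q) + 1 else 0 := by
  simp only [prefixAssociate, prefixCode, Encodable.encodek, List.length_map, List.length_range]

theorem kleene_prefixAssociate (g : List ℕ → ℕ) (q : Baire) :
    kleene (prefixAssociate g) q = Part.some fun n => g ((List.range n).map q) := by
  have defined_iff (n k : ℕ) : prefixAssociate g (prefixCode n q k) ≠ 0 ↔ k = n := by
    simp [prefixAssociate_prefixCode]
  have dom : (kleene (prefixAssociate g) q).Dom := fun n => ⟨n, (defined_iff n n).2 rfl⟩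
  refine Part.eq_some_iff.2 ⟨dom, funext fun n => ?_⟩
  have find_eq : Nat.find (dom n) = n := (defined_iff n _).1 (Nat.find_spec (dom n))
  change prefixAssociate g (prefixCode n q (Nat.find (dom n))) - 1 = _
  rw [find_eq, prefixAssociate_prefixCode, if_pos rfl, Nat.add_sub_cancel]

theorem continuous_prefixAssociate {A : Type*} [TopologicalSpace A] {g : A → List ℕ → ℕ}
    (hg : ∀ w, Continuous fun a => g a w) : Continuous fun a => prefixAssociate (g a) := by
  refine continuous_pi fun c => ?_
  unfold prefixAssociate
  rcases (Encodable.decode c : Option (ℕ × List ℕ)) with _ | ⟨n, w⟩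
  · exact continuous_const
  · dsimp only
    split_ifs
    · exact (hg w).add continuous_const
    · exact continuous_const

open Classical in
/-- The test whether the word `w`, together with the prefix of `p` of the same length, already
guarantees membership in `W`, with value `1` for success. -/
noncomputable def rectangleTest (W : Set (Baire × Baire)) (p : Baire) (w : List ℕ) : ℕ :=
  if PiNat.cylinder p w.length ×ˢ {q | (List.range w.length).map q = w} ⊆ W then 1 else 0

theorem rectangleTest_map_range_ne_zero_iff {W : Set (Baire × Baire)} {p q : Baire} {n : ℕ} :
    rectangleTest W p ((List.range n).map q) ≠ 0 ↔
      PiNat.cylinder p n ×ˢ PiNat.cylinder q n ⊆ W := by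
  simp only [rectangleTest, List.length_map, List.length_range, map_range_eq_map_range_iff,
    Set.ofPred_mem_eq, ne_eq, ite_eq_right_iff, one_ne_zero, imp_false, not_not]

theorem continuous_rectangleTest (W : Set (Baire × Baire)) (w : List ℕ) :
    Continuous fun p => rectangleTest W p w := by
  refine ((IsLocallyConstant.iff_eventually_eq _).2 fun p => ?_).continuous
  filter_upwards [(hasAntitoneBasis_nhds_cylinder p).mem w.length] with p' hp'
  rw [rectangleTest, rectangleTest, PiNat.mem_cylinder_iff_eq.1 hp']

theorem exists_continuous_kleene_of_isOpen {W : Set (Baire × Baire)} (hW : IsOpen W) :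
    ∃ F : Baire → Baire, Continuous F ∧
      ∀ p q, ∃ r ∈ kleene (F p) q, ((p, q) ∈ W ↔ ∃ n, r n ≠ 0) := by
  refine ⟨fun p => prefixAssociate (rectangleTest W p),
    continuous_prefixAssociate (continuous_rectangleTest W), fun p q =>
      ⟨_, Part.eq_some_iff.1 (kleene_prefixAssociate _ q), ?_⟩⟩
  have basis := (hasAntitoneBasis_nhds_cylinder p).prod (hasAntitoneBasis_nhds_cylinder q)
  simp only [rectangleTest_map_range_ne_zero_iff]
  calc (p, q) ∈ W ↔ W ∈ 𝓝 (p, q) := hW.mem_nhds_iff.symm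
    _ ↔ ∃ n, PiNat.cylinder p n ×ˢ PiNat.cylinder q n ⊆ W := by
      rw [nhds_prod_eq, basis.mem_iff]

namespace BaireRep

variable {Y : Type*} (δ : BaireRep Y)

theorem namesOpen_iff {p : Baire} {U : δ.OpenSets} :
    δ.NamesOpen p U ↔
      ∀ q, ∀ y ∈ δ.toPFun q, ∃ r ∈ kleene p q, (y ∈ U.1 ↔ ∃ n, r n ≠ 0) := by
  refine forall₃_congr fun q y _ => ?_
  simp only [sierpinski, PFun.coe_val, Part.mem_some_iff, forall_eq]
  simp only [eq_iff_iff]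

theorem exists_isOpen_mem_iff_of_namesOpen (y : Y) :
    ∃ W : Set Baire, IsOpen W ∧ ∀ p U, δ.NamesOpen p U → (p ∈ W ↔ y ∈ U.1) := by
  obtain ⟨q, hq⟩ := δ.surj y
  have nonzero_open : IsOpen {r : Baire | ∃ n, r n ≠ 0} := by
    have nonzero_eq : {r : Baire | ∃ n, r n ≠ 0} = {0}ᶜ := Set.ext fun r => Function.ne_iff.symm
    exact nonzero_eq ▸ isOpen_compl_singleton
  obtain ⟨W, hW, hWr⟩ :=
    isOpen_induced_iff.1 (nonzero_open.preimage (partialContinuous_kleene_left q))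
  refine ⟨W, hW, fun p U hp => ?_⟩
  obtain ⟨r, ⟨hdom, rfl⟩, hr⟩ := δ.namesOpen_iff.1 hp q y hq
  exact (Set.ext_iff.1 hWr ⟨p, hdom⟩).trans hr.symm

theorem exists_continuous_namesOpen {s : Set Baire} (U : s → δ.OpenSets)
    (hU : IsOpen {a : s × δ.toPFun.Dom | δ.toPFun.asSubtype a.2 ∈ (U a.1).1}) :
    ∃ F : Baire → Baire, Continuous F ∧ ∀ p : s, δ.NamesOpen (F p) (U p) := by
  obtain ⟨W, hW, hWU⟩ :=
    (IsInducing.subtypeVal.prodMap IsInducing.subtypeVal).isOpen_iff.1 hU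
  obtain ⟨F, hF, hFW⟩ := exists_continuous_kleene_of_isOpen hW
  refine ⟨F, hF, fun p => δ.namesOpen_iff.2 ?_⟩
  rintro q _ ⟨hq, rfl⟩
  obtain ⟨r, hr, hrW⟩ := hFW p q
  exact ⟨r, hr, (Set.ext_iff.1 hWU (p, ⟨q, hq⟩)).symm.trans hrW⟩

end BaireRep

namespace IsPresubbase

variable {X Y : Type*} {δY : BaireRep Y} {B : Y → Set X}

theorem mem_rep_iff_namesOpen (hB : IsPresubbase δY B) {p : Baire} {x : X} :
    x ∈ hB.rep.toPFun p ↔ δY.NamesOpen p (hB.transpose x) :=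
  (hB.mem_rep p x).trans (δY.mem_openSets p _)

theorem partialContinuous_rep (hB : IsPresubbase δY B) :
    PartialContinuous (TopologicalSpace.generateFrom (Set.range B)) hB.rep.toPFun := by
  refine continuous_generateFrom_iff.2 (Set.forall_mem_range.2 fun y => ?_)
  obtain ⟨W, hW, hWy⟩ := δY.exists_isOpen_mem_iff_of_namesOpen y
  refine isOpen_induced_iff.2 ⟨W, hW, Set.ext fun p => ?_⟩
  exact hWy p _ (hB.mem_rep_iff_namesOpen.1 (Part.get_mem p.2))

end IsPresubbase

namespace ConvergentIntersectionProperty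

variable {X Y : Type*} {δY : BaireRep Y} {B : Y → Set X}

theorem eventually_mem_of_tendsto (hconv : ConvergentIntersectionProperty δY B)
    {x : ℕ → X} {xInf : X} {y : ℕ → Y} {yInf : Y}
    (hopen : IsOpen[δY.finalTopology] {y | xInf ∈ B y})
    (hx : Tendsto x atTop (@nhds X (TopologicalSpace.generateFrom (Set.range B)) xInf))
    (hy : Tendsto y atTop (@nhds Y δY.finalTopology yInf)) (hmem : xInf ∈ B yInf) :
    ∀ᶠ n in atTop, x n ∈ B (y n) := by
  let _ : TopologicalSpace X := TopologicalSpace.generateFrom (Set.range B)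
  let _ : TopologicalSpace Y := δY.finalTopology
  obtain ⟨N, hN⟩ := eventually_atTop.1 (hy.eventually_mem (hopen.mem_nhds hmem))
  obtain ⟨F, hF, hFB⟩ := hconv (fun n => y (n + N)) yInf (hy.comp (tendsto_add_atTop_nat N))
  have nhds_inter : (⋂ n, B (y (n + N))) ∩ B yInf ∈ 𝓝 xInf := by
    refine IsOpen.mem_nhds ?_ ⟨Set.mem_iInter.2 fun n => hN _ (Nat.le_add_left N n), hmem⟩
    exact hFB ▸ hF.isOpen_biInter fun z _ =>
      TopologicalSpace.isOpen_generateFrom_of_mem (Set.mem_range_self z)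
  filter_upwards [hx.eventually_mem nhds_inter, eventually_ge_atTop N] with n hxn hn
  simpa only [Nat.sub_add_cancel hn] using Set.mem_iInter.1 hxn.1 (n - N)

theorem isOpen_setOf_mem (hconv : ConvergentIntersectionProperty δY B)
    (hopen : ∀ x, IsOpen[δY.finalTopology] {y | x ∈ B y})
    {S T : Type*} [TopologicalSpace S] [TopologicalSpace T]
    [FirstCountableTopology S] [FirstCountableTopology T] {f : S → X} {g : T → Y}
    (hf : Continuous[_, TopologicalSpace.generateFrom (Set.range B)] f)
    (hg : Continuous[_, δY.finalTopology] g) :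
    IsOpen {a : S × T | f a.1 ∈ B (g a.2)} := by
  refine isOpen_iff_mem_nhds.2 fun a ha => eventually_iff_seq_eventually.2 fun u hu => ?_
  have hu_fst : Tendsto (fun n => (u n).1) atTop (𝓝 a.1) := hu.fst_nhds
  have hu_snd : Tendsto (fun n => (u n).2) atTop (𝓝 a.2) := hu.snd_nhds
  exact hconv.eventually_mem_of_tendsto (hopen (f a.1))
    ((@Continuous.tendsto _ _ _ (_) _ hf a.1).comp hu_fst)
    ((@Continuous.tendsto _ _ _ (_) _ hg a.2).comp hu_snd) ha

end ConvergentIntersectionProperty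

theorem corollary12 {X Y : Type*} (δY : BaireRep Y) (B : Y → Set X) (hB : IsPresubbase δY B)
    (hconv : ConvergentIntersectionProperty δY B) :
    hB.rep.Admissible (TopologicalSpace.generateFrom (Set.range B)) := by
  refine ⟨hB.partialContinuous_rep, fun δ hδ => ?_⟩
  have mem_open : IsOpen {a : δ.toPFun.Dom × δY.toPFun.Dom |
      δ.toPFun.asSubtype a.1 ∈ B (δY.toPFun.asSubtype a.2)} :=
    hconv.isOpen_setOf_mem hB.isOpen_transpose hδ continuous_coinduced_rng
  obtain ⟨F, hF, hF_names⟩ :=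
    δY.exists_continuous_namesOpen (fun p => hB.transpose (δ.toPFun.asSubtype p)) mem_open
  refine ⟨(F : Baire →. Baire), hF.comp continuous_subtype_val, ?_⟩
  rintro p _ ⟨-, rfl⟩ _ ⟨hp, rfl⟩
  exact ⟨F p, Part.mem_some _, hB.mem_rep_iff_namesOpen.2 (hF_names ⟨p, hp⟩)⟩
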